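/- Let $G$ be a countable discrete group and $H\le G$ a subgroup with the spectral gap property: the trivial representation $1_H$ is not weakly contained in the natural unitary representation of $H$ on $\ell^2(G/H\setminus\{H\})$. (Here a unitary representation $\rho$ of a group $\Gamma$ is weakly contained in $\pi$ if $\|\rho(x)\|\le\|\pi(x)\|$ for all $x\in C^*(\Gamma)$, equivalently for all $x\in\mathbf{C}[\Gamma]$.) Let $\sigma$ be an irreducible unitary representation of $H$ on a finite-dimensional complex Hilbert space $\mathcal K$, and let $\pi=\operatorname{Ind}_H^G\sigma$ be the induced representation, acting by $(\pi(g)F)(x)=F(g^{-1}x)$ on the Hilbert space $\mathcal H$ of maps $F:G\to\mathcal K$ with $F(xh)=\sigma(h^{-1})F(x)$ for all $x\in G$, $h\in H$ and $\sum_{x\in G/H}\|F(x)\|^2<\infty$. Let $C^*_\pi(G)$ be the norm closure in $\mathcal B(\mathcal H)$ of $\{\sum_{s\in G} f(s)\pi(s) : f\in\mathbf{C}[G]\}$. Then $C^*_\pi(G)$ has a unique smallest nonzero closed two-sided ideal $I_{\min}$, that is, a nonzero closed two-sided ideal contained in every nonzero closed two-sided ideal of $C^*_\pi(G)$; moreover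 $I_{\min}=\mathcal K(\mathcal H)$, the algebra of all compact operators on $\mathcal H$ (in particular, $\mathcal K(\mathcal H)\subset C^*_\pi(G)$). -/

import Mathlib

noncomputable section

namespace SpectralGapInd

/-- Unitary representations of the discrete group `G` on the Hilbert space `E`. -/
abbrev URep (G : Type*) [Group G] (E : Type*) [NormedAddCommGroup E] [InnerProductSpace ℂ E]
    [CompleteSpace E] :=
  G →* unitary (E →L[ℂ] E)

section General

variable {G : Type*} [Group G] {E : Type*} [NormedAddCommGroup E] [InnerProductSpace ℂ E]
  [CompleteSpace E] {F : Type*} [NormedAddCommGroup F] [InnerProductSpace ℂ F] [CompleteSpace F]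

/-- A linear action of `G` by norm-preserving maps, as a unitary representation. -/
def URep.ofIsometric (U : G →* Module.End ℂ E) (hU : ∀ g v, ‖U g v‖ = ‖v‖) : URep G E :=
  (Unitary.linearIsometryEquiv (𝕜 := ℂ) (H := E)).symm.toMonoidHom.comp
    { toFun := fun g =>
        { toFun := U g
          map_add' := map_add (U g)
          map_smul' := map_smul (U g)
          invFun := U g⁻¹
          left_inv := fun v => by
            rw [← Module.End.mul_apply, ← map_mul, inv_mul_cancel, map_one, Module.End.one_apply]
          right_inv := fun v => by
            rw [← Module.End.mul_apply, ← map_mul, mul_inv_cancel, map_one, Module.End.one_apply]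
          norm_map' := hU g }
      map_one' := by ext v; exact congrArg (fun T : Module.End ℂ E => T v) (map_one U)
      map_mul' := fun g h => by
        ext v; exact congrArg (fun T : Module.End ℂ E => T v) (map_mul U g h) }

theorem URep.ofIsometric_apply (U : G →* Module.End ℂ E) (hU : ∀ g v, ‖U g v‖ = ‖v‖)
    (g : G) (v : E) : (URep.ofIsometric U hU g : E →L[ℂ] E) v = U g v := rfl

/-- Irreducibility: the space is nonzero and has no closed invariant subspaces other than
`0` and itself. -/
def URep.IsIrreducible (π : URep G E) : Prop :=
  Nontrivial E ∧ ∀ W : Submodule ℂ E, IsClosed (W : Set E) →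
    (∀ g : G, ∀ v ∈ W, (π g : E →L[ℂ] E) v ∈ W) → W = ⊥ ∨ W = ⊤

/-- The extension of `π` to the group algebra, `f ↦ ∑ f(s) π(s)`. -/
def URep.toAlgHom (π : URep G E) : MonoidAlgebra ℂ G →ₐ[ℂ] (E →L[ℂ] E) :=
  MonoidAlgebra.lift ℂ (E →L[ℂ] E) G ((unitary (E →L[ℂ] E)).subtype.comp π)

theorem URep.toAlgHom_single (π : URep G E) (g : G) (c : ℂ) :
    π.toAlgHom (MonoidAlgebra.single g c) = c • (π g : E →L[ℂ] E) := by
  simp [URep.toAlgHom]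

theorem URep.star_toAlgHom_mem (π : URep G E) (f : MonoidAlgebra ℂ G) :
    star (π.toAlgHom f) ∈ π.toAlgHom.range := by
  induction f using MonoidAlgebra.induction_linear with
  | zero => simp
  | add f₁ f₂ h₁ h₂ => rw [map_add, star_add]; exact add_mem h₁ h₂
  | single g c =>
    refine ⟨MonoidAlgebra.single g⁻¹ (star c), ?_⟩
    change π.toAlgHom _ = _
    rw [URep.toAlgHom_single, URep.toAlgHom_single, star_smul, map_inv]
    rfl

/-- The `*`-algebra `{π(f) | f ∈ ℂ[G]}`. -/
def URep.starAlg (π : URep G E) : StarSubalgebra ℂ (E →L[ℂ] E) :=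
  { π.toAlgHom.range with
    star_mem' := by
      rintro _ ⟨f, rfl⟩
      exact π.star_toAlgHom_mem f }

/-- The C⋆-algebra generated by `π`: the operator-norm closure of `{π(f) | f ∈ ℂ[G]}`. -/
def URep.cstar (π : URep G E) : StarSubalgebra ℂ (E →L[ℂ] E) :=
  π.starAlg.topologicalClosure

/-- Weak containment `ρ ≺ π`: `‖ρ(x)‖ ≤ ‖π(x)‖` for all `x`. Both sides are continuous in `x`
for the norm of the maximal C⋆-algebra of `G`, in which the group algebra is dense, so it is the
same to let `x` run over the group algebra. -/
def URep.WeaklyContained (ρ : URep G F) (π : URep G E) : Prop :=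
  ∀ x : MonoidAlgebra ℂ G, ‖ρ.toAlgHom x‖ ≤ ‖π.toAlgHom x‖

end General

section Permutation

variable {G : Type*} [Group G] {X : Type*} [MulAction G X]

/-- The complex Hilbert space `ℓ²(X)`. -/
abbrev Ell2 (X : Type*) := lp (fun _ : X => ℂ) 2

theorem memℓp_two_iff {ι E : Type*} [NormedAddCommGroup E] (f : ι → E) :
    Memℓp f 2 ↔ Summable fun i => ‖f i‖ ^ 2 := by
  rw [memℓp_gen_iff (by norm_num)]
  norm_num

theorem norm_sq_eq_tsum {ι E : Type*} [NormedAddCommGroup E] (f : lp (fun _ : ι => E) 2) :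
    ‖f‖ ^ 2 = ∑' i, ‖f i‖ ^ 2 := by
  have h := lp.norm_rpow_eq_tsum (p := 2) (by norm_num) f
  norm_num at h
  exact h

/-- Translation on `ℓ²(X)`: `(g f)(x) = f(g⁻¹ x)`. -/
def permEnd (G : Type*) [Group G] (X : Type*) [MulAction G X] : G →* Module.End ℂ (Ell2 X) where
  toFun g :=
    { toFun := fun f => ⟨fun x => f (g⁻¹ • x), by
        have hf := (memℓp_two_iff _).1 f.2
        exact (memℓp_two_iff _).2 ((MulAction.toPerm (β := X) g⁻¹).summable_iff.2 hf)⟩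
      map_add' := fun f₁ f₂ => rfl
      map_smul' := fun c f => rfl }
  map_one' := by
    ext f x
    change f ((1 : G)⁻¹ • x) = f x
    rw [inv_one, one_smul]
  map_mul' g h := by
    ext f x
    change f ((g * h)⁻¹ • x) = f (h⁻¹ • g⁻¹ • x)
    rw [mul_inv_rev, mul_smul]

theorem norm_permEnd (g : G) (f : Ell2 X) : ‖permEnd G X g f‖ = ‖f‖ := by
  rw [← sq_eq_sq₀ (norm_nonneg _) (norm_nonneg _), norm_sq_eq_tsum, norm_sq_eq_tsum]
  exact (MulAction.toPerm (β := X) g⁻¹).tsum_eq fun x => ‖f x‖ ^ 2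

/-- The natural representation of `G` on `ℓ²(X)` for an action of `G` on the set `X`. -/
def permRep (G : Type*) [Group G] (X : Type*) [MulAction G X] : URep G (Ell2 X) :=
  URep.ofIsometric (permEnd G X) norm_permEnd

theorem permRep_apply (g : G) (f : Ell2 X) (x : X) :
    (permRep G X g : Ell2 X →L[ℂ] Ell2 X) f x = f (g⁻¹ • x) := rfl

/-- The action of `G` on `X` has a spectral gap: the trivial one-dimensional representation is not
weakly contained in the natural representation on `ℓ²(X)`. -/
def HasSpectralGap (G : Type*) [Group G] (X : Type*) [MulAction G X] : Prop :=
  ¬ URep.WeaklyContained (1 : URep G ℂ) (permRep G X)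

/-- The `H`-invariant set `G/H ∖ {H}`. -/
def cosetsNeBase {G : Type*} [Group G] (H : Subgroup G) : SubMulAction H (G ⧸ H) where
  carrier := {((1 : G) : G ⧸ H)}ᶜ
  smul_mem' := by
    intro h q hq hq'
    apply hq
    have hb : h • (((1 : G) : G ⧸ H)) = ((1 : G) : G ⧸ H) := by
      change (((h : G) * 1 : G) : G ⧸ H) = ((1 : G) : G ⧸ H)
      rw [mul_one, QuotientGroup.eq]
      simp
    have hq'' : h • q = ((1 : G) : G ⧸ H) := hq'
    rw [← hb] at hq''
    exact MulAction.injective h hq''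

/-- The subgroup `H` of `G` has the spectral gap property. -/
def SpectralGapProperty {G : Type*} [Group G] (H : Subgroup G) : Prop :=
  HasSpectralGap H (cosetsNeBase H)

end Permutation

section Induced

variable {G : Type*} [Group G] {H : Subgroup G} {K : Type*} [NormedAddCommGroup K]
  [InnerProductSpace ℂ K] [CompleteSpace K]

/-- The maps `F : G → K` with `F(xh) = σ(h⁻¹) F(x)` and `∑_{x ∈ G/H} ‖F(x)‖² < ∞`. By the first
condition `‖F(x)‖` depends only on the coset `xH`; the sum is formed with the representatives
`q.out`. -/
def indSubmodule (σ : URep H K) : Submodule ℂ (G → K) where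
  carrier := {F | (∀ (x : G) (h : H), F (x * h) = (σ h⁻¹ : K →L[ℂ] K) (F x)) ∧
    Summable fun q : G ⧸ H => ‖F q.out‖ ^ 2}
  zero_mem' := ⟨fun x h => by simp, by simp⟩
  add_mem' := by
    rintro F₁ F₂ ⟨h₁, s₁⟩ ⟨h₂, s₂⟩
    refine ⟨fun x h => by simp [h₁, h₂], ?_⟩
    rw [← memℓp_two_iff (fun q : G ⧸ H => F₁ q.out)] at s₁
    rw [← memℓp_two_iff (fun q : G ⧸ H => F₂ q.out)] at s₂
    exact (memℓp_two_iff _).1 (s₁.add s₂)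
  smul_mem' := by
    rintro c F ⟨h, s⟩
    refine ⟨fun x k => by simp [h], ?_⟩
    rw [← memℓp_two_iff (fun q : G ⧸ H => F q.out)] at s
    exact (memℓp_two_iff _).1 (s.const_smul c)

/-- The space of the induced representation. It is a type of its own, so that it does not inherit
the topology of pointwise convergence. -/
def IndSpace (σ : URep H K) : Type _ := indSubmodule σ

instance (σ : URep H K) : AddCommGroup (IndSpace σ) :=
  inferInstanceAs (AddCommGroup (indSubmodule σ))

instance (σ : URep H K) : Module ℂ (IndSpace σ) :=
  inferInstanceAs (Module ℂ (indSubmodule σ))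

instance (σ : URep H K) : FunLike (IndSpace σ) G K where
  coe F := Subtype.val (p := fun F : G → K => F ∈ indSubmodule σ) F
  coe_injective _ _ h := Subtype.ext h

/-- An element of the space of the induced representation from its two defining properties. -/
def IndSpace.mk {σ : URep H K} (F : G → K)
    (h₁ : ∀ (x : G) (h : H), F (x * h) = (σ h⁻¹ : K →L[ℂ] K) (F x))
    (h₂ : Summable fun q : G ⧸ H => ‖F q.out‖ ^ 2) : IndSpace σ :=
  (⟨F, h₁, h₂⟩ : indSubmodule σ)

theorem IndSpace.mk_apply {σ : URep H K} (F : G → K)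
    (h₁ : ∀ (x : G) (h : H), F (x * h) = (σ h⁻¹ : K →L[ℂ] K) (F x))
    (h₂ : Summable fun q : G ⧸ H => ‖F q.out‖ ^ 2) (x : G) : IndSpace.mk F h₁ h₂ x = F x := rfl

theorem IndSpace.ext {σ : URep H K} {F₁ F₂ : IndSpace σ} (h : ∀ x, F₁ x = F₂ x) : F₁ = F₂ :=
  DFunLike.ext F₁ F₂ h

theorem IndSpace.apply_mul {σ : URep H K} (F : IndSpace σ) (x : G) (h : H) :
    F (x * h) = (σ h⁻¹ : K →L[ℂ] K) (F x) :=
  (Subtype.property (p := fun F : G → K => F ∈ indSubmodule σ) F).1 x h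

theorem IndSpace.summable {σ : URep H K} (F : IndSpace σ) :
    Summable fun q : G ⧸ H => ‖F q.out‖ ^ 2 :=
  (Subtype.property (p := fun F : G → K => F ∈ indSubmodule σ) F).2

theorem IndSpace.norm_apply_mul {σ : URep H K} (F : IndSpace σ) (x : G) (h : H) :
    ‖F (x * h)‖ = ‖F x‖ := by
  rw [F.apply_mul x h, Unitary.norm_map]

theorem IndSpace.norm_apply_eq {σ : URep H K} (F : IndSpace σ) {x y : G}
    (hxy : (x : G ⧸ H) = (y : G ⧸ H)) : ‖F x‖ = ‖F y‖ := by
  have h := F.norm_apply_mul x ⟨x⁻¹ * y, QuotientGroup.eq.1 hxy⟩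
  rw [← h]
  simp

/-- Restriction to coset representatives identifies the space with `ℓ²(G/H, K)`. -/
def IndSpace.toLp (σ : URep H K) : IndSpace σ ≃ₗ[ℂ] lp (fun _ : G ⧸ H => K) 2 where
  toFun F := ⟨fun q => F q.out, (memℓp_two_iff _).2 F.summable⟩
  map_add' F₁ F₂ := rfl
  map_smul' c F := rfl
  invFun f := IndSpace.mk
    (fun x => (σ ⟨x⁻¹ * (x : G ⧸ H).out, QuotientGroup.eq.1 (by simp)⟩ : K →L[ℂ] K)
      (f (x : G ⧸ H)))
    (fun x h => by
      have hq : ((x * h : G) : G ⧸ H) = (x : G ⧸ H) := by simp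
      rw [← mul_apply_eq_comp, ← Submonoid.coe_mul, ← map_mul]
      simp only [hq]
      congr 4
      simp [mul_assoc])
    (((memℓp_two_iff _).1 f.2).congr fun q => by
      rw [Unitary.norm_map]
      simp)
  left_inv F := by
    apply IndSpace.ext
    intro x
    have hx : (x : G ⧸ H) = ((x : G ⧸ H).out : G ⧸ H) := by simp
    have h := F.apply_mul x ⟨x⁻¹ * (x : G ⧸ H).out, QuotientGroup.eq.1 hx⟩
    simp only [mul_inv_cancel_left] at h
    rw [IndSpace.mk_apply]
    change (σ _ : K →L[ℂ] K) (F _) = F x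
    rw [h, ← mul_apply_eq_comp, ← Submonoid.coe_mul, ← map_mul]
    simp
  right_inv f := by
    ext q
    change (σ _ : K →L[ℂ] K) (f ((q.out : G) : G ⧸ H)) = f q
    have hq : ((q.out : G) : G ⧸ H) = q := by simp
    have h1 : (⟨q.out⁻¹ * ((q.out : G) : G ⧸ H).out, QuotientGroup.eq.1 (by simp)⟩ : H) = 1 := by
      ext
      simp
    rw [h1, map_one, hq]
    rfl

/-- The norm is `‖F‖ = (∑_{x ∈ G/H} ‖F(x)‖²)^(1/2)`. -/
instance (σ : URep H K) : NormedAddCommGroup (IndSpace σ) :=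
  NormedAddCommGroup.induced (IndSpace σ) (lp (fun _ : G ⧸ H => K) 2)
    (IndSpace.toLp σ).toLinearMap (IndSpace.toLp σ).injective

theorem IndSpace.norm_toLp {σ : URep H K} (F : IndSpace σ) : ‖IndSpace.toLp σ F‖ = ‖F‖ := rfl

theorem IndSpace.norm_sq {σ : URep H K} (F : IndSpace σ) :
    ‖F‖ ^ 2 = ∑' q : G ⧸ H, ‖F q.out‖ ^ 2 :=
  norm_sq_eq_tsum (IndSpace.toLp σ F)

/-- The inner product is `∑_{x ∈ G/H} ⟪F₁(x), F₂(x)⟫`. -/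
instance (σ : URep H K) : InnerProductSpace ℂ (IndSpace σ) where
  norm_smul_le c F := by
    rw [← IndSpace.norm_toLp, map_smul, norm_smul, IndSpace.norm_toLp]
  inner F₁ F₂ := inner ℂ (IndSpace.toLp σ F₁) (IndSpace.toLp σ F₂)
  norm_sq_eq_re_inner F := norm_sq_eq_re_inner (𝕜 := ℂ) (IndSpace.toLp σ F)
  conj_inner_symm F₁ F₂ := inner_conj_symm (𝕜 := ℂ) (IndSpace.toLp σ F₁) (IndSpace.toLp σ F₂)
  add_left F₁ F₂ F₃ := by rw [map_add, inner_add_left]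
  smul_left F₁ F₂ c := by rw [map_smul, inner_smul_left]

theorem IndSpace.inner_eq {σ : URep H K} (F₁ F₂ : IndSpace σ) :
    inner ℂ F₁ F₂ = ∑' q : G ⧸ H, inner ℂ (F₁ q.out) (F₂ q.out) := rfl

instance (σ : URep H K) : CompleteSpace (IndSpace σ) := by
  let e : IndSpace σ ≃ₗᵢ[ℂ] lp (fun _ : G ⧸ H => K) 2 :=
    { IndSpace.toLp σ with norm_map' := IndSpace.norm_toLp }
  exact e.toIsometryEquiv.completeSpace

theorem IndSpace.norm_translate {σ : URep H K} (F : IndSpace σ) (g : G) (q : G ⧸ H) :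
    ‖F (g⁻¹ * q.out)‖ = ‖F (MulAction.toPerm (β := G ⧸ H) g⁻¹ q).out‖ := by
  apply F.norm_apply_eq
  rw [QuotientGroup.out_eq']
  change g⁻¹ • ((q.out : G) : G ⧸ H) = g⁻¹ • q
  rw [QuotientGroup.out_eq']

/-- Left translation `(g F)(x) = F(g⁻¹ x)`. -/
def indEnd (σ : URep H K) : G →* Module.End ℂ (IndSpace σ) where
  toFun g :=
    { toFun := fun F => IndSpace.mk (fun x => F (g⁻¹ * x))
        (fun x h => by rw [← mul_assoc, F.apply_mul])
        (by
          simp only [IndSpace.norm_translate F g]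
          exact (MulAction.toPerm (β := G ⧸ H) g⁻¹).summable_iff.2 F.summable)
      map_add' := fun F₁ F₂ => rfl
      map_smul' := fun c F => rfl }
  map_one' := by
    refine LinearMap.ext fun F => IndSpace.ext fun x => ?_
    change F ((1 : G)⁻¹ * x) = F x
    simp
  map_mul' g h := by
    refine LinearMap.ext fun F => IndSpace.ext fun x => ?_
    change F ((g * h)⁻¹ * x) = F (h⁻¹ * (g⁻¹ * x))
    rw [mul_inv_rev, mul_assoc]

theorem norm_indEnd (σ : URep H K) (g : G) (F : IndSpace σ) : ‖indEnd σ g F‖ = ‖F‖ := by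
  rw [← sq_eq_sq₀ (norm_nonneg _) (norm_nonneg _), IndSpace.norm_sq, IndSpace.norm_sq]
  change ∑' q : G ⧸ H, ‖F (g⁻¹ * q.out)‖ ^ 2 = _
  simp only [IndSpace.norm_translate F g]
  exact (MulAction.toPerm (β := G ⧸ H) g⁻¹).tsum_eq fun q => ‖F q.out‖ ^ 2

/-- The induced representation `Ind_H^G σ`, acting by left translation. -/
def indRep (σ : URep H K) : URep G (IndSpace σ) :=
  URep.ofIsometric (indEnd σ) (norm_indEnd σ)

theorem indRep_apply (σ : URep H K) (g : G) (F : IndSpace σ) (x : G) :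
    (indRep σ g : IndSpace σ →L[ℂ] IndSpace σ) F x = F (g⁻¹ * x) := rfl

end Induced

/-- The nonzero closed two-sided ideals of a topological ring. -/
def nonzeroClosedIdeals (A : Type*) [Ring A] [TopologicalSpace A] : Set (TwoSidedIdeal A) :=
  {J | IsClosed (J : Set A) ∧ J ≠ ⊥}

end SpectralGapInd

end

/-! It suffices to put every rank one operator into `(indRep σ).cstar`. The algebra is closed, so it
then contains all compact operators, and compressing a nonzero `b` between rank one operators shows
that every nonzero closed ideal contains them too.

The spectral gap yields a finitely supported probability measure `y` on `H` with norm less than one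
on `ℓ²(G/H ∖ {H})` (`exists_norm_lt_one_of_not_weaklyContained`). Its convolution powers are again
probability measures, and their norms tend to zero. Weight `y ^ n` by a matrix coefficient `φ` of
`σ` and apply the result in the induced representation. On functions vanishing on `H`, pointwise
domination by the permutation representation makes these operators tend to zero
(`IndSpace.norm_weighted_le`). On functions supported in `H`, a copy of `K`, they act as `∑ y ^ n
(s) φ(s) σ(s)`, which stay bounded in the finite-dimensional algebra `B(K)` and so have a limit
point. The weights prevent all these limits from vanishing: summed over an orthonormal basis, the
coefficients reproduce `‖σ(s) v‖ ^ 2 = 1` (`URep.sum_inner_weighted`). Thus the closed algebra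
contains a nonzero operator living on the corner `B(K)` (`exists_corner_mem_cstar`).

By irreducibility and Burnside's theorem, multiplying by elements of `ℂ[H]` on both sides turns it
into every operator of the corner. Translating by `G` then gives rank one operators on a total set
of vectors. -/

namespace SpectralGapInd

open InnerProductSpace Filter Topology
open scoped NNReal

/-! ### Rank one operators, compact operators and minimal ideals -/

section CompactOperators

variable {E : Type*} [NormedAddCommGroup E] [InnerProductSpace ℂ E] [CompleteSpace E]

/-- A closed subspace of `B(E)` containing the rank one operators contains the compact ones. -/
theorem mem_of_isCompactOperator {S : Submodule ℂ (E →L[ℂ] E)}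
    (hS : IsClosed (S : Set (E →L[ℂ] E))) (h : ∀ u v : E, rankOne ℂ u v ∈ S)
    {T : E →L[ℂ] E} (hT : IsCompactOperator T) : T ∈ S := by
  rw [← SetLike.mem_coe, ← hS.closure_eq, Metric.mem_closure_iff]
  intro ε hε
  have hc : TotallyBounded (T '' Metric.closedBall 0 1) :=
    ((IsCompactOperator.isCompact_closure_image_closedBall (f := (T : E →ₗ[ℂ] E)) hT
      1).totallyBounded).subset subset_closure
  obtain ⟨t, ht, htc⟩ := Metric.totallyBounded_iff.1 hc (ε / 2) (half_pos hε)
  set V : Submodule ℂ E := Submodule.span ℂ t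
  have : FiniteDimensional ℂ V := FiniteDimensional.span_of_finite ℂ ht
  let b := stdOrthonormalBasis ℂ V
  refine ⟨V.starProjection ∘L T, ?_, ?_⟩
  · have hP : V.starProjection ∘L T =
        ∑ i, rankOne ℂ (b i : E) (ContinuousLinearMap.adjoint T (b i : E)) := by
      ext x
      rw [ContinuousLinearMap.comp_apply, Submodule.starProjection_apply,
        b.orthogonalProjectionOnto_apply_eq_sum]
      simp [ContinuousLinearMap.adjoint_inner_left]
    rw [hP]
    exact S.sum_mem fun i _ => h _ _
  · rw [dist_eq_norm]
    refine lt_of_le_of_lt ?_ (half_lt_self hε)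
    refine ContinuousLinearMap.opNorm_le_of_unit_norm (by positivity) fun x hx => ?_
    have hxT : T x ∈ T '' Metric.closedBall 0 1 := ⟨x, by simp [hx], rfl⟩
    obtain ⟨y, hy, hxy⟩ := Set.mem_iUnion₂.1 (htc hxT)
    -- The projection of `T x` is its nearest point in `V`, hence at least as near as the net point
    -- `y`.
    rw [sub_apply, ContinuousLinearMap.comp_apply,
      Submodule.starProjection_minimal]
    refine (ciInf_le ⟨0, by rintro _ ⟨z, rfl⟩; positivity⟩
      (⟨y, Submodule.subset_span hy⟩ : V)).trans ?_
    rw [← dist_eq_norm]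
    exact (Metric.mem_ball.1 hxy).le

theorem isCompactOperator_rankOne {E : Type*} [NormedAddCommGroup E] [InnerProductSpace ℂ E]
    (u v : E) : IsCompactOperator (rankOne ℂ u v : E →L[ℂ] E) := by
  rw [rankOne_def']
  exact (isCompactOperator_of_locallyCompactSpace_dom (innerSL ℂ v)).clm_comp
    (ContinuousLinearMap.toSpanSingleton ℂ u)

/-- A closed subspace of `B(E)` containing the rank one operators with vectors from a total set
contains all of them. -/
theorem rankOne_mem_of_dense_span {S : Submodule ℂ (E →L[ℂ] E)}
    (hS : IsClosed (S : Set (E →L[ℂ] E))) {D : Set E}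
    (hD : Dense (Submodule.span ℂ D : Set E))
    (h : ∀ u ∈ D, ∀ v ∈ D, rankOne ℂ u v ∈ S) (u v : E) : rankOne ℂ u v ∈ S := by
  have h₁ : ∀ u ∈ D, ∀ v, rankOne ℂ u v ∈ S := by
    intro u hu v
    refine hD.induction ?_ (hS.preimage (rankOne ℂ u : E →L⋆[ℂ] E →L[ℂ] E).continuous) v
    intro v hv
    induction hv using Submodule.span_induction with
    | mem v hv => exact h u hu v hv
    | zero => simp
    | add v w _ _ hv hw => rw [map_add]; exact S.add_mem hv hw
    | smul c v _ hv => rw [map_smulₛₗ]; exact S.smul_mem _ hv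
  have hc : Continuous fun u : E => (rankOne ℂ u v : E →L[ℂ] E) :=
    (ContinuousLinearMap.apply' (E →L[ℂ] E) (starRingEnd ℂ) v).continuous.comp
      (rankOne ℂ : E →L[ℂ] E →L⋆[ℂ] E →L[ℂ] E).continuous
  refine hD.induction (P := fun u => rankOne ℂ u v ∈ S) ?_ (hS.preimage hc) u
  intro u hu
  induction hu using Submodule.span_induction with
  | mem u hu => exact h₁ u hu v
  | zero => simp
  | add u w _ _ hu hw => rw [map_add, add_apply]; exact S.add_mem hu hw
  | smul c u _ hu => rw [map_smul, smul_apply]; exact S.smul_mem _ hu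

/-- The ideal of compact operators in an algebra of operators. -/
noncomputable def compactIdeal (A : StarSubalgebra ℂ (E →L[ℂ] E)) : TwoSidedIdeal A :=
  TwoSidedIdeal.mk' {a | IsCompactOperator (a : E →L[ℂ] E)} isCompactOperator_zero
    (fun ha hb => ha.add hb) (fun ha => ha.neg)
    (fun {a _} hb => hb.clm_comp (a : E →L[ℂ] E)) (fun {_ b} ha => ha.comp_clm (b : E →L[ℂ] E))

theorem mem_compactIdeal {A : StarSubalgebra ℂ (E →L[ℂ] E)} {a : A} :
    a ∈ compactIdeal A ↔ IsCompactOperator (a : E →L[ℂ] E) :=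
  TwoSidedIdeal.mem_mk' ..

/-- If a closed algebra of operators contains the rank one operators, then the compact operators
form its smallest nonzero closed ideal. -/
theorem isLeast_compactIdeal [Nontrivial E] {A : StarSubalgebra ℂ (E →L[ℂ] E)}
    (hA : IsClosed (A : Set (E →L[ℂ] E))) (h : ∀ u v : E, rankOne ℂ u v ∈ A) :
    IsLeast (nonzeroClosedIdeals A) (compactIdeal A) := by
  refine ⟨⟨?_, fun hbot => ?_⟩, ?_⟩
  · have : (compactIdeal A : Set A) =
        Subtype.val ⁻¹' {T : E →L[ℂ] E | IsCompactOperator T} := by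
      ext a; exact mem_compactIdeal
    rw [this]
    exact isClosed_setOfPred_isCompactOperator.preimage continuous_subtype_val
  · obtain ⟨u, hu⟩ := exists_ne (0 : E)
    have hm : (⟨rankOne ℂ u u, h u u⟩ : A) ∈ compactIdeal A :=
      mem_compactIdeal.2 (isCompactOperator_rankOne u u)
    rw [hbot, TwoSidedIdeal.mem_bot] at hm
    exact rankOne_ne_zero hu hu (congrArg Subtype.val hm)
  · rintro J ⟨hJ, hJ0⟩ a ha
    obtain ⟨b, hbJ, hb⟩ : ∃ b ∈ J, b ≠ 0 := by
      by_contra! hc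
      exact hJ0 (le_bot_iff.1 fun b hb => (TwoSidedIdeal.mem_bot A).2 (hc b hb))
    obtain ⟨x, hx⟩ : ∃ x, (b : E →L[ℂ] E) x ≠ 0 := by
      by_contra! hc
      exact hb (Subtype.ext (ContinuousLinearMap.ext hc))
    let S : Submodule ℂ (E →L[ℂ] E) :=
      { carrier := Subtype.val '' (J : Set A)
        zero_mem' := ⟨0, J.zero_mem, rfl⟩
        add_mem' := by
          rintro _ _ ⟨c, hc, rfl⟩ ⟨d, hd, rfl⟩
          exact ⟨c + d, J.add_mem hc hd, rfl⟩
        smul_mem' := by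
          rintro z _ ⟨c, hc, rfl⟩
          refine ⟨z • c, ?_, rfl⟩
          rw [Algebra.smul_def]
          exact J.mul_mem_left _ _ hc }
    have hS : IsClosed (S : Set (E →L[ℂ] E)) := hA.isClosedEmbedding_subtypeVal.isClosedMap _ hJ
    have hr : ∀ u v : E, rankOne ℂ u v ∈ S := by
      intro u v
      -- Sandwiching `b` gives `(u ⊗ y) b (x ⊗ v) = ⟪y, y⟫ (u ⊗ v)`, and the scalar is invertible.
      set y := (b : E →L[ℂ] E) x
      have hm := J.mul_mem_left (⟨rankOne ℂ u y, h u y⟩ : A) _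
        (J.mul_mem_right _ (⟨rankOne ℂ x v, h x v⟩ : A) hbJ)
      have hyy : inner ℂ y y ≠ (0 : ℂ) := inner_self_ne_zero.2 hx
      have h₁ : (inner ℂ y y)⁻¹ • (rankOne ℂ u y * ((b : E →L[ℂ] E) * rankOne ℂ x v)) ∈ S :=
        S.smul_mem _ ⟨_, hm, rfl⟩
      convert h₁ using 1
      ext w
      simp only [rankOne_apply, smul_apply, mul_apply_eq_comp,
        map_smul, smul_smul]
      congr 1
      change _ = _ * (_ * inner ℂ y y)
      field_simp
    obtain ⟨c, hc, hca⟩ := mem_of_isCompactOperator hS hr (mem_compactIdeal.1 ha)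
    rwa [← Subtype.ext hca]

end CompactOperators

/-! ### Burnside's theorem -/

section Burnside

variable {H : Type*} [Group H] {K : Type*} [NormedAddCommGroup K] [InnerProductSpace ℂ K]
  [CompleteSpace K] [FiniteDimensional ℂ K]

/-- Burnside's theorem: a finite-dimensional irreducible representation spans all operators. -/
theorem URep.IsIrreducible.toAlgHom_surjective {σ : URep H K} (hσ : σ.IsIrreducible) :
    Function.Surjective σ.toAlgHom := by
  let R := σ.toAlgHom.range
  have := hσ.1
  have : IsScalarTower ℂ R K := ⟨fun _ _ _ => rfl⟩
  have hsimple : IsSimpleModule R K := by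
    refine (isSimpleModule_iff R K).2 { eq_bot_or_eq_top := fun W => ?_ }
    have hW := hσ.2 (W.restrictScalars ℂ) (Submodule.closed_of_finiteDimensional _) fun g v hv =>
      W.smul_mem (⟨(σ g : K →L[ℂ] K), MonoidAlgebra.single g 1, by
        change σ.toAlgHom _ = _
        rw [URep.toAlgHom_single, one_smul]⟩ : R) hv
    simpa using hW
  intro T
  -- By Schur's lemma the commutant of `R` consists of scalars, so any `T` is linear over it. The
  -- density theorem then matches `T` with an element of `R` on a basis.
  let f : Module.End (Module.End R K) K :=
    { toFun := T
      map_add' := map_add T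
      map_smul' := fun g v => by
        obtain ⟨c, rfl⟩ :=
          (IsSimpleModule.algebraMap_end_bijective_of_isAlgClosed (A := R) (V := K) ℂ).2 g
        exact map_smul T c v }
  let b := Module.finBasis ℂ K
  classical
  obtain ⟨⟨_, x, rfl⟩, hr⟩ := jacobson_density (R := R) f (Finset.univ.image b)
  refine ⟨x, ?_⟩
  apply ContinuousLinearMap.coe_injective
  refine b.ext fun i => ?_
  exact (hr (b i) (Finset.mem_image_of_mem _ (Finset.mem_univ i))).symm

end Burnside

/-! ### Spectral gap and contracting probability measures -/

section Averages

variable {Γ : Type*} [Group Γ] {E : Type*} [NormedAddCommGroup E] [InnerProductSpace ℂ E]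
  [CompleteSpace E]

/-- The inclusion of the nonnegative functions into the complex group algebra. -/
noncomputable def nnToComplex (Γ : Type*) [Group Γ] :
    MonoidAlgebra ℝ≥0 Γ →+* MonoidAlgebra ℂ Γ :=
  MonoidAlgebra.mapRingHom Γ (algebraMap ℝ≥0 ℂ)

theorem URep.toAlgHom_nnToComplex (π : URep Γ E) (y : MonoidAlgebra ℝ≥0 Γ) :
    π.toAlgHom (nnToComplex Γ y) =
      ∑ s ∈ y.coeff.support, ((y.coeff s : ℝ) : ℂ) • (π s : E →L[ℂ] E) := by
  rw [URep.toAlgHom, MonoidAlgebra.lift_apply, Finsupp.sum_of_support_subset (s := y.coeff.support)]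
  · refine Finset.sum_congr rfl fun s _ => ?_
    rw [nnToComplex, MonoidAlgebra.coeff_mapRingHom]
    rfl
  · intro s hs
    rw [nnToComplex, Finsupp.mem_support_iff, MonoidAlgebra.coeff_mapRingHom] at hs
    rw [Finsupp.mem_support_iff]
    rintro h
    simp [h] at hs
  · simp

/-- The total mass of a nonnegative function of finite support. -/
noncomputable def mass (Γ : Type*) [Group Γ] : MonoidAlgebra ℝ≥0 Γ →ₐ[ℝ≥0] ℝ≥0 :=
  MonoidAlgebra.lift ℝ≥0 ℝ≥0 Γ 1

theorem mass_eq_sum (y : MonoidAlgebra ℝ≥0 Γ) : mass Γ y = ∑ s ∈ y.coeff.support, y.coeff s := by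
  simp [mass, MonoidAlgebra.lift_apply, Finsupp.sum]

/-- Averaging a vector with its translates contracts the norm by a definite amount if the
translates are far from the vector on average. -/
theorem norm_half_add_average_sq_le {E : Type*} [NormedAddCommGroup E] [InnerProductSpace ℂ E]
    {ι : Type*} (S : Finset ι) (p : ι → ℝ)
    (hp : ∀ s ∈ S, 0 ≤ p s) (hp1 : ∑ s ∈ S, p s = 1) (x : E) (u : ι → E)
    (hu : ∀ s ∈ S, ‖u s‖ = ‖x‖) {η : ℝ} (hη : 0 ≤ η)
    (h : η * ‖x‖ ≤ ∑ s ∈ S, p s * ‖u s - x‖) :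
    ‖(2⁻¹ : ℂ) • (x + ∑ s ∈ S, (p s : ℂ) • u s)‖ ^ 2 ≤ (1 - η ^ 2 / 4) * ‖x‖ ^ 2 := by
  have h₁ : x + ∑ s ∈ S, (p s : ℂ) • u s = ∑ s ∈ S, (p s : ℂ) • (x + u s) := by
    simp only [smul_add, Finset.sum_add_distrib, ← Finset.sum_smul, ← Complex.ofReal_sum, hp1,
      Complex.ofReal_one, one_smul]
  have h₂ : ‖x + ∑ s ∈ S, (p s : ℂ) • u s‖ ≤ ∑ s ∈ S, p s * ‖x + u s‖ := by
    rw [h₁]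
    refine (norm_sum_le _ _).trans (Finset.sum_le_sum fun s hs => ?_)
    rw [norm_smul, Complex.norm_real, Real.norm_of_nonneg (hp s hs)]
  -- Jensen's inequality passes to means of squares, where the parallelogram law `h₅` converts the
  -- mean displacement into a loss of norm.
  have h₃ := Real.pow_arith_mean_le_arith_mean_pow S p (fun s => ‖x + u s‖) hp hp1
    (fun s _ => norm_nonneg _) 2
  have h₄ := Real.pow_arith_mean_le_arith_mean_pow S p (fun s => ‖u s - x‖) hp hp1
    (fun s _ => norm_nonneg _) 2
  have h₅ : ∑ s ∈ S, p s * ‖x + u s‖ ^ 2 + ∑ s ∈ S, p s * ‖u s - x‖ ^ 2 = 4 * ‖x‖ ^ 2 := by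
    rw [← Finset.sum_add_distrib, ← mul_one (4 * ‖x‖ ^ 2), ← hp1, Finset.mul_sum]
    refine Finset.sum_congr rfl fun s hs => ?_
    have := parallelogram_law_with_norm ℂ x (u s)
    rw [hu s hs, norm_sub_rev x] at this
    linear_combination p s * this
  have h₆ : ‖x + ∑ s ∈ S, (p s : ℂ) • u s‖ ^ 2 ≤ (∑ s ∈ S, p s * ‖x + u s‖) ^ 2 := by gcongr
  have h₇ : (η * ‖x‖) ^ 2 ≤ (∑ s ∈ S, p s * ‖u s - x‖) ^ 2 := by gcongr
  have h₈ : ‖(2⁻¹ : ℂ)‖ = 2⁻¹ := by norm_num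
  rw [norm_smul, h₈, mul_pow]
  rw [mul_pow] at h₇
  linarith

/-- If the trivial representation is not weakly contained in `π`, then some probability measure of
finite support acts as a strict contraction. -/
theorem exists_norm_lt_one_of_not_weaklyContained {π : URep Γ E}
    (h : ¬ URep.WeaklyContained (1 : URep Γ ℂ) π) :
    ∃ y : MonoidAlgebra ℝ≥0 Γ, mass Γ y = 1 ∧ ‖π.toAlgHom (nnToComplex Γ y)‖ < 1 := by
  rw [URep.WeaklyContained] at h
  push Not at h
  obtain ⟨x, hx⟩ := h
  set S := x.coeff.support with hS
  set N : ℝ≥0 := ∑ s ∈ S, ‖x.coeff s‖₊ with hN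
  set e : ℂ := ∑ s ∈ S, x.coeff s with he
  have hπx : π.toAlgHom x = ∑ s ∈ S, x.coeff s • (π s : E →L[ℂ] E) := by
    rw [URep.toAlgHom, MonoidAlgebra.lift_apply]; rfl
  have hex : ‖(1 : URep Γ ℂ).toAlgHom x‖ ≤ ‖e‖ := by
    have : (1 : URep Γ ℂ).toAlgHom x = e • (1 : ℂ →L[ℂ] ℂ) := by
      rw [URep.toAlgHom, MonoidAlgebra.lift_apply, he]
      exact (Finset.sum_smul (f := fun s => x.coeff s)).symm
    rw [this, norm_smul]
    exact mul_le_of_le_one_right (norm_nonneg _) ContinuousLinearMap.norm_id_le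
  have hδ : 0 < ‖e‖ - ‖π.toAlgHom x‖ := by linarith
  have heN : ‖e‖ ≤ N := by
    rw [he, hN, NNReal.coe_sum]
    exact norm_sum_le _ _
  have hN0 : 0 < (N : ℝ) := by linarith [norm_nonneg (π.toAlgHom x)]
  -- The gap between the two norms, divided by the `ℓ¹` norm of `x`, bounds below the mean
  -- displacement of a unit vector under the measure `p = |x| / N`.
  set η : ℝ := (‖e‖ - ‖π.toAlgHom x‖) / N with hηdef
  have hη : 0 < η := div_pos hδ hN0
  let p : Γ → ℝ≥0 := fun s => ‖x.coeff s‖₊ / N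
  have hp1 : ∑ s ∈ S, p s = 1 := by
    simp only [p]
    rw [← Finset.sum_div, div_self]
    exact_mod_cast hN0.ne'
  have hgap : ∀ v : E, η * ‖v‖ ≤ ∑ s ∈ S, (p s : ℝ) * ‖(π s : E →L[ℂ] E) v - v‖ := by
    intro v
    have h₁ : ‖e • v - π.toAlgHom x v‖ ≤ ∑ s ∈ S, ‖x.coeff s‖ * ‖(π s : E →L[ℂ] E) v - v‖ := by
      rw [hπx, he, Finset.sum_smul, sum_apply, ← Finset.sum_sub_distrib]
      refine (norm_sum_le _ _).trans (Finset.sum_le_sum fun s _ => ?_)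
      rw [smul_apply, ← smul_sub, norm_smul, norm_sub_rev]
    have h₂ : ‖e‖ * ‖v‖ - ‖π.toAlgHom x‖ * ‖v‖ ≤ ‖e • v - π.toAlgHom x v‖ := by
      have h₃ := norm_sub_norm_le (e • v) (π.toAlgHom x v)
      have h₄ := (π.toAlgHom x).le_opNorm v
      rw [norm_smul] at h₃
      linarith
    have h₅ : ∑ s ∈ S, (p s : ℝ) * ‖(π s : E →L[ℂ] E) v - v‖ =
        (∑ s ∈ S, ‖x.coeff s‖ * ‖(π s : E →L[ℂ] E) v - v‖) / N := by
      rw [Finset.sum_div]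
      refine Finset.sum_congr rfl fun s _ => ?_
      simp only [p, NNReal.coe_div, coe_nnnorm]
      ring
    rw [h₅, hηdef, div_mul_eq_mul_div]
    gcongr
    linarith
  -- Half the mass sits at the identity, so that each vector is averaged with its own translates.
  let y : MonoidAlgebra ℝ≥0 Γ :=
    (2⁻¹ : ℝ≥0) • (1 + ∑ s ∈ S, MonoidAlgebra.single s (p s))
  have hy : π.toAlgHom (nnToComplex Γ y) =
      (2⁻¹ : ℂ) • (1 + ∑ s ∈ S, ((p s : ℝ) : ℂ) • (π s : E →L[ℂ] E)) := by
    have hsmul : nnToComplex Γ y =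
        (2⁻¹ : ℂ) • (1 + ∑ s ∈ S, MonoidAlgebra.single s ((p s : ℝ) : ℂ)) := by
      simp only [y, nnToComplex]
      rw [Algebra.smul_def, map_mul, map_add, map_one, map_sum, Algebra.smul_def]
      congr 1
      · simp only [MonoidAlgebra.coe_algebraMap, Function.comp_apply, Algebra.algebraMap_self,
          RingHom.id_apply, MonoidAlgebra.coe_mapRingHom, MonoidAlgebra.map_single, map_inv₀]
        congr 2
        exact (map_inv₀ (algebraMap ℝ≥0 ℂ) 2).trans (congrArg _ (map_ofNat (algebraMap ℝ≥0 ℂ) 2))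
      · congr 1
        refine Finset.sum_congr rfl fun s _ => ?_
        rw [MonoidAlgebra.coe_mapRingHom, MonoidAlgebra.map_single]
        rfl
    rw [hsmul, map_smul, map_add, map_one, map_sum]
    simp only [URep.toAlgHom_single]
  refine ⟨y, ?_, ?_⟩
  · simp only [y, mass, map_smul, map_add, map_one, map_sum, MonoidAlgebra.lift_single,
      MonoidHom.one_apply, smul_eq_mul, mul_one, hp1]
    norm_num
  · rw [hy]
    refine lt_of_le_of_lt (b := Real.sqrt (1 - η ^ 2 / 4)) ?_ ?_
    · refine ContinuousLinearMap.opNorm_le_bound _ (Real.sqrt_nonneg _) fun v => ?_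
      have h₁ := norm_half_add_average_sq_le S (fun s => (p s : ℝ)) (fun s _ => (p s).2)
        (by exact_mod_cast hp1) v (fun s => (π s : E →L[ℂ] E) v)
        (fun s _ => Unitary.norm_map _ _) hη.le (hgap v)
      have h₂ := Real.sqrt_le_sqrt h₁
      rw [Real.sqrt_sq (norm_nonneg _), Real.sqrt_mul' _ (sq_nonneg _),
        Real.sqrt_sq (norm_nonneg _)] at h₂
      simpa [sum_apply] using h₂
    · rw [Real.sqrt_lt' one_pos]
      nlinarith [sq_pos_of_pos hη]

end Averages

/-! ### Vectors supported in `H` and vectors vanishing on `H` -/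

section Induced

variable {G : Type*} [Group G] {H : Subgroup G} {K : Type*} [NormedAddCommGroup K]
  [InnerProductSpace ℂ K] [CompleteSpace K]

/-- Evaluation at a point. -/
def IndSpace.evalₗ (σ : URep H K) (x : G) : IndSpace σ →ₗ[ℂ] K where
  toFun F := F x
  map_add' _ _ := rfl
  map_smul' _ _ := rfl

theorem IndSpace.norm_apply_le {σ : URep H K} (F : IndSpace σ) (x : G) : ‖F x‖ ≤ ‖F‖ := by
  rw [F.norm_apply_eq (y := (x : G ⧸ H).out) (by simp), ← IndSpace.norm_toLp]
  exact lp.norm_apply_le_norm two_ne_zero (IndSpace.toLp σ F) (x : G ⧸ H)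

/-- Evaluation at the identity. -/
noncomputable def IndSpace.evalOne (σ : URep H K) : IndSpace σ →L[ℂ] K :=
  (IndSpace.evalₗ σ 1).mkContinuous 1 fun F => by
    rw [one_mul]; exact F.norm_apply_le 1

theorem IndSpace.evalOne_apply {σ : URep H K} (F : IndSpace σ) : IndSpace.evalOne σ F = F 1 := rfl

theorem IndSpace.apply_of_mem {σ : URep H K} (F : IndSpace σ) (h : H) :
    F h = (σ h⁻¹ : K →L[ℂ] K) (F 1) := by
  rw [← F.apply_mul, one_mul]

theorem IndSpace.evalOne_indRep {σ : URep H K} (h : H) (F : IndSpace σ) :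
    IndSpace.evalOne σ ((indRep σ (h : G) : IndSpace σ →L[ℂ] IndSpace σ) F) =
      (σ h : K →L[ℂ] K) (IndSpace.evalOne σ F) := by
  rw [evalOne_apply, indRep_apply, mul_one, ← Subgroup.coe_inv, F.apply_of_mem, inv_inv]
  rfl

theorem out_one_mem : ((1 : G) : G ⧸ H).out ∈ H := by
  have : ((((1 : G) : G ⧸ H).out : G) : G ⧸ H) = ((1 : G) : G ⧸ H) := QuotientGroup.out_eq' _
  simpa using QuotientGroup.eq.1 this.symm

theorem out_notMem {q : G ⧸ H} (hq : q ≠ ((1 : G) : G ⧸ H)) : q.out ∉ H := by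
  intro h
  apply hq
  rw [← QuotientGroup.out_eq' q, eq_comm, QuotientGroup.eq]
  simpa using h

open Classical in
/-- The function with value `u` at the identity that vanishes outside `H`. -/
noncomputable def IndSpace.baseFun (σ : URep H K) (u : K) (x : G) : K :=
  if hx : x ∈ H then (σ ⟨x, hx⟩⁻¹ : K →L[ℂ] K) u else 0

theorem IndSpace.baseFun_of_mem (σ : URep H K) (u : K) (h : H) :
    IndSpace.baseFun σ u (h : G) = (σ h⁻¹ : K →L[ℂ] K) u :=
  dif_pos h.2

theorem IndSpace.baseFun_of_notMem (σ : URep H K) (u : K) {x : G} (hx : x ∉ H) :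
    IndSpace.baseFun σ u x = 0 :=
  dif_neg hx

/-- The vector with value `u` at the identity that vanishes outside `H`. -/
noncomputable def IndSpace.base (σ : URep H K) : K →ₗ[ℂ] IndSpace σ where
  toFun u := IndSpace.mk (IndSpace.baseFun σ u)
    (fun x h => by
      by_cases hx : x ∈ H
      · lift x to H using hx
        rw [← Subgroup.coe_mul, baseFun_of_mem, baseFun_of_mem, ← mul_apply_eq_comp,
          ← Submonoid.coe_mul, ← map_mul, mul_inv_rev]
      · have hxh : x * h ∉ H := fun hc => hx ((H.mul_mem_cancel_right h.2).1 hc)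
        rw [baseFun_of_notMem _ _ hx, baseFun_of_notMem _ _ hxh, map_zero])
    (summable_of_ne_finset_zero (s := {((1 : G) : G ⧸ H)}) fun q hq => by
      rw [baseFun_of_notMem _ _ (out_notMem (by simpa using hq))]
      simp)
  map_add' u v := IndSpace.ext fun x => by
    change baseFun σ (u + v) x = baseFun σ u x + baseFun σ v x
    unfold baseFun
    split_ifs <;> simp
  map_smul' c u := IndSpace.ext fun x => by
    change baseFun σ (c • u) x = c • baseFun σ u x
    unfold baseFun
    split_ifs <;> simp

theorem IndSpace.base_apply_of_mem {σ : URep H K} (u : K) (h : H) :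
    IndSpace.base σ u (h : G) = (σ h⁻¹ : K →L[ℂ] K) u :=
  dif_pos h.2

theorem IndSpace.base_apply_of_notMem {σ : URep H K} (u : K) {x : G} (hx : x ∉ H) :
    IndSpace.base σ u x = 0 :=
  dif_neg hx

theorem IndSpace.base_apply_one {σ : URep H K} (u : K) : IndSpace.base σ u (1 : G) = u := by
  have := IndSpace.base_apply_of_mem (σ := σ) u 1
  simpa using this

theorem IndSpace.inner_base {σ : URep H K} (u : K) (F : IndSpace σ) :
    inner ℂ (IndSpace.base σ u) F = inner ℂ u (F 1) := by
  rw [IndSpace.inner_eq, tsum_eq_single ((1 : G) : G ⧸ H)]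
  · lift ((1 : G) : G ⧸ H).out to H using out_one_mem with h
    rw [base_apply_of_mem, F.apply_of_mem]
    exact (Unitary.linearIsometryEquiv (σ h⁻¹)).inner_map_map _ _
  · intro q hq
    rw [base_apply_of_notMem _ (out_notMem hq), inner_zero_left]

/-- This allows the corner embedding to be built by composing with evaluation and its adjoint, which
makes it continuous in the operator on `K`. -/
theorem IndSpace.base_eq_adjoint {σ : URep H K} (u : K) :
    IndSpace.base σ u = ContinuousLinearMap.adjoint (IndSpace.evalOne σ) u := by
  refine ext_inner_right ℂ fun F => ?_
  rw [IndSpace.inner_base, ContinuousLinearMap.adjoint_inner_left]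
  rfl

theorem IndSpace.indRep_base {σ : URep H K} (h : H) (u : K) :
    (indRep σ (h : G) : IndSpace σ →L[ℂ] IndSpace σ) (IndSpace.base σ u) =
      IndSpace.base σ ((σ h : K →L[ℂ] K) u) := by
  refine IndSpace.ext fun x => ?_
  rw [indRep_apply]
  by_cases hx : x ∈ H
  · lift x to H using hx
    rw [← Subgroup.coe_inv, ← Subgroup.coe_mul, base_apply_of_mem, base_apply_of_mem,
      ← mul_apply_eq_comp, ← Submonoid.coe_mul, ← map_mul, mul_inv_rev, inv_inv]
  · rw [base_apply_of_notMem _ hx, base_apply_of_notMem]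
    rwa [← Subgroup.coe_inv, H.mul_mem_cancel_left (SetLike.coe_mem _)]

/-- The inner product of `F` with the translate by `g` of the base vector of `u` is `⟪u, F g⟫`;
taking `u = F g` shows that an orthogonal `F` vanishes at `g`. -/
theorem IndSpace.dense_span_translates (σ : URep H K) :
    Dense (Submodule.span ℂ {F | ∃ (g : G) (u : K),
      (indRep σ g : IndSpace σ →L[ℂ] IndSpace σ) (IndSpace.base σ u) = F} :
        Set (IndSpace σ)) := by
  rw [Submodule.dense_iff_topologicalClosure_eq_top, Submodule.topologicalClosure_eq_top_iff,
    Submodule.eq_bot_iff]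
  intro F hF
  refine IndSpace.ext fun g => ?_
  rw [Submodule.mem_orthogonal] at hF
  have h := hF _ (Submodule.subset_span ⟨g, F g, rfl⟩)
  have h₁ : inner ℂ ((indRep σ g : IndSpace σ →L[ℂ] IndSpace σ) (IndSpace.base σ (F g))) F =
      inner ℂ (IndSpace.base σ (F g))
        ((indRep σ g⁻¹ : IndSpace σ →L[ℂ] IndSpace σ) F) := by
    rw [← ContinuousLinearMap.adjoint_inner_right, map_inv]
    rfl
  rw [h₁, IndSpace.inner_base, indRep_apply, inv_inv, mul_one, inner_self_eq_zero] at h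
  exact h

/-- The function `‖F‖` on the cosets other than `H`. -/
noncomputable def IndSpace.absOff {σ : URep H K} (F : IndSpace σ) : Ell2 (cosetsNeBase H) :=
  ⟨fun q => (‖F (q : G ⧸ H).out‖ : ℂ), (memℓp_two_iff _).2 (by
    simp only [Complex.norm_real, norm_norm]
    exact F.summable.subtype (cosetsNeBase H : Set (G ⧸ H)))⟩

theorem IndSpace.absOff_apply {σ : URep H K} (F : IndSpace σ) (q : cosetsNeBase H) :
    F.absOff q = (‖F (q : G ⧸ H).out‖ : ℂ) := rfl

theorem IndSpace.norm_absOff {σ : URep H K} {F : IndSpace σ} (hF : F 1 = 0) :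
    ‖F.absOff‖ = ‖F‖ := by
  rw [← sq_eq_sq₀ (norm_nonneg _) (norm_nonneg _), norm_sq_eq_tsum, IndSpace.norm_sq]
  simp only [absOff_apply, Complex.norm_real, norm_norm]
  refine tsum_subtype_eq_of_support_subset (f := fun q : G ⧸ H => ‖F q.out‖ ^ 2)
    (s := (cosetsNeBase H : Set (G ⧸ H))) fun q hq hq1 => hq ?_
  obtain rfl : q = ((1 : G) : G ⧸ H) := hq1
  have := F.apply_of_mem ⟨_, out_one_mem⟩
  simp only [hF, map_zero] at this
  simp [this]

/-- Evaluation at a point. -/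
def Ell2.evalₗ {X : Type*} (x : X) : Ell2 X →ₗ[ℂ] ℂ where
  toFun f := f x
  map_add' _ _ := rfl
  map_smul' _ _ := rfl

theorem permRep_nnToComplex_apply {Γ X : Type*} [Group Γ] [MulAction Γ X]
    (y : MonoidAlgebra ℝ≥0 Γ) (f : Ell2 X) (x : X) :
    (permRep Γ X).toAlgHom (nnToComplex Γ y) f x =
      ∑ s ∈ y.coeff.support, ((y.coeff s : ℝ) : ℂ) * f (s⁻¹ • x) := by
  change Ell2.evalₗ x ((permRep Γ X).toAlgHom (nnToComplex Γ y) f) = _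
  rw [URep.toAlgHom_nnToComplex, sum_apply, map_sum (Ell2.evalₗ x)]
  rfl

theorem Ell2.norm_le_norm {X : Type*} {f g : Ell2 X} (h : ∀ x, ‖f x‖ ≤ ‖g x‖) : ‖f‖ ≤ ‖g‖ := by
  rw [← sq_le_sq₀ (norm_nonneg _) (norm_nonneg _), norm_sq_eq_tsum, norm_sq_eq_tsum]
  refine Summable.tsum_le_tsum (fun x => ?_) ((memℓp_two_iff _).1 f.2) ((memℓp_two_iff _).1 g.2)
  gcongr
  exact h x

/-- The operator `∑ y(s) φ(s) π(s)` of the group `Γ`. -/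
noncomputable def URep.weighted {Γ : Type*} [Group Γ] {E : Type*} [NormedAddCommGroup E]
    [InnerProductSpace ℂ E] [CompleteSpace E] (π : URep Γ E) (y : MonoidAlgebra ℝ≥0 Γ)
    (φ : Γ → ℂ) : E →L[ℂ] E :=
  ∑ s ∈ y.coeff.support, (((y.coeff s : ℝ) : ℂ) * φ s) • (π s : E →L[ℂ] E)

/-- By the triangle inequality, the norm of the image at each point is at most the value there of
`y` acting on the scalar function `‖F‖`. Nonnegativity of `y` is essential, while the phases of `φ`
and the twist by `σ` drop out. -/
theorem IndSpace.norm_weighted_le {σ : URep H K} (y : MonoidAlgebra ℝ≥0 H) {φ : H → ℂ}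
    (hφ : ∀ s, ‖φ s‖ ≤ 1) {F : IndSpace σ} (hF : F 1 = 0) :
    ‖URep.weighted ((indRep σ).comp H.subtype) y φ F‖ ≤
      ‖(permRep H (cosetsNeBase H)).toAlgHom (nnToComplex H y)‖ * ‖F‖ := by
  set T := URep.weighted ((indRep σ).comp H.subtype) y φ with hT
  set Λ := (permRep H (cosetsNeBase H)).toAlgHom (nnToComplex H y) with hΛ
  have hTF : ∀ x, T F x = ∑ s ∈ y.coeff.support,
      (((y.coeff s : ℝ) : ℂ) * φ s) • F ((s : G)⁻¹ * x) := by
    intro x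
    change IndSpace.evalₗ σ x (T F) = _
    rw [hT, URep.weighted, sum_apply, map_sum]
    rfl
  have hTF1 : T F 1 = 0 := by
    rw [hTF]
    refine Finset.sum_eq_zero fun s _ => ?_
    rw [mul_one, ← Subgroup.coe_inv, F.apply_of_mem, hF, map_zero, smul_zero]
  have hΛF : ∀ q, Λ F.absOff q = ((∑ s ∈ y.coeff.support,
      (y.coeff s : ℝ) * ‖F ((s : G)⁻¹ * (q : G ⧸ H).out)‖ : ℝ) : ℂ) := by
    intro q
    rw [hΛ, permRep_nnToComplex_apply, Complex.ofReal_sum]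
    refine Finset.sum_congr rfl fun s _ => ?_
    rw [IndSpace.norm_translate, Complex.ofReal_mul]
    rfl
  rw [← IndSpace.norm_absOff hTF1, ← IndSpace.norm_absOff hF]
  refine le_trans ?_ (Λ.le_opNorm _)
  refine Ell2.norm_le_norm fun q => ?_
  rw [hΛF, absOff_apply, Complex.norm_real, Complex.norm_real, norm_norm, hTF]
  refine le_trans ?_ (le_abs_self _)
  refine (norm_sum_le _ _).trans (Finset.sum_le_sum fun s _ => ?_)
  rw [norm_smul, norm_mul, Complex.norm_real, NNReal.norm_eq]
  gcongr
  exact mul_le_of_le_one_right (NNReal.coe_nonneg _) (hφ s)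

end Induced

/-! ### The corner `B(K)` and the rank one operators -/

section Main

variable {G : Type*} [Group G] {H : Subgroup G} {K : Type*} [NormedAddCommGroup K]
  [InnerProductSpace ℂ K] [CompleteSpace K]

theorem URep.apply_mem_cstar {Γ : Type*} [Group Γ] {E : Type*} [NormedAddCommGroup E]
    [InnerProductSpace ℂ E] [CompleteSpace E] (π : URep Γ E) (g : Γ) :
    (π g : E →L[ℂ] E) ∈ π.cstar := by
  refine π.starAlg.le_topologicalClosure ⟨MonoidAlgebra.single g 1, ?_⟩
  change π.toAlgHom _ = _
  rw [URep.toAlgHom_single, one_smul]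

theorem URep.isClosed_cstar {Γ : Type*} [Group Γ] {E : Type*} [NormedAddCommGroup E]
    [InnerProductSpace ℂ E] [CompleteSpace E] (π : URep Γ E) :
    IsClosed (π.cstar : Set (E →L[ℂ] E)) :=
  π.starAlg.isClosed_topologicalClosure

/-- The operator on the induced space acting by `t` on the vectors supported in `H` and by zero
on those vanishing on `H`. -/
noncomputable def IndSpace.corner (σ : URep H K) :
    (K →L[ℂ] K) →L[ℂ] (IndSpace σ →L[ℂ] IndSpace σ) :=
  (ContinuousLinearMap.compL ℂ (IndSpace σ) K (IndSpace σ)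
      (ContinuousLinearMap.adjoint (IndSpace.evalOne σ))) ∘L
    ((ContinuousLinearMap.compL ℂ (IndSpace σ) K K).flip (IndSpace.evalOne σ))

theorem IndSpace.corner_apply {σ : URep H K} (t : K →L[ℂ] K) (F : IndSpace σ) :
    IndSpace.corner σ t F = IndSpace.base σ (t (F 1)) := by
  rw [IndSpace.base_eq_adjoint]
  rfl

theorem IndSpace.corner_rankOne {σ : URep H K} (u w : K) :
    IndSpace.corner σ (rankOne ℂ u w) = rankOne ℂ (IndSpace.base σ u) (IndSpace.base σ w) := by
  ext F
  rw [corner_apply, rankOne_apply, rankOne_apply, inner_base, map_smul]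

/-- Every operator `σ(x)` is implemented on the corner by an element of the algebra of the
induced representation. -/
theorem IndSpace.exists_mem_cstar_intertwining {σ : URep H K} (x : MonoidAlgebra ℂ H) :
    ∃ a ∈ (indRep σ).cstar, (∀ u, a (IndSpace.base σ u) = IndSpace.base σ (σ.toAlgHom x u)) ∧
      ∀ F, a F 1 = σ.toAlgHom x (F 1) := by
  induction x using MonoidAlgebra.induction_linear with
  | zero => exact ⟨0, zero_mem _, fun u => by simp, fun F => by rw [map_zero]; rfl⟩
  | add x y hx hy =>
    obtain ⟨a, ha, ha₁, ha₂⟩ := hx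
    obtain ⟨b, hb, hb₁, hb₂⟩ := hy
    refine ⟨a + b, add_mem ha hb, fun u => ?_, fun F => ?_⟩
    · rw [add_apply, ha₁, hb₁, map_add, add_apply, map_add]
    · rw [map_add, add_apply (σ.toAlgHom x), ← ha₂, ← hb₂]; rfl
  | single h c =>
    refine ⟨c • (indRep σ (h : G) : IndSpace σ →L[ℂ] IndSpace σ),
      (indRep σ).cstar.smul_mem (URep.apply_mem_cstar _ _) c, fun u => ?_, fun F => ?_⟩
    · rw [URep.toAlgHom_single, smul_apply, smul_apply, indRep_base, map_smul]
    · rw [URep.toAlgHom_single]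
      exact congrArg (c • ·) (IndSpace.evalOne_indRep h F)

theorem IndSpace.weighted_base {σ : URep H K} (y : MonoidAlgebra ℝ≥0 H) (φ : H → ℂ) (u : K) :
    URep.weighted ((indRep σ).comp H.subtype) y φ (IndSpace.base σ u) =
      IndSpace.base σ (URep.weighted σ y φ u) := by
  rw [URep.weighted, URep.weighted, sum_apply, sum_apply, map_sum]
  refine Finset.sum_congr rfl fun s _ => ?_
  rw [smul_apply, smul_apply, map_smul, ← indRep_base]
  rfl

theorem IndSpace.weighted_mem_cstar {σ : URep H K} (y : MonoidAlgebra ℝ≥0 H) (φ : H → ℂ) :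
    URep.weighted ((indRep σ).comp H.subtype) y φ ∈ (indRep σ).cstar :=
  sum_mem fun s _ => (indRep σ).cstar.smul_mem (URep.apply_mem_cstar (indRep σ) (s : G)) _

/-- The two operators agree on vectors supported in `H`, so only the part of `F` vanishing on `H`
contributes. The last factor does not depend on `y`, which is all that the limit argument needs. -/
theorem IndSpace.norm_weighted_sub_corner_le {σ : URep H K} (y : MonoidAlgebra ℝ≥0 H)
    {φ : H → ℂ} (hφ : ∀ s, ‖φ s‖ ≤ 1) :
    ‖URep.weighted ((indRep σ).comp H.subtype) y φ - IndSpace.corner σ (URep.weighted σ y φ)‖ ≤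
      ‖(permRep H (cosetsNeBase H)).toAlgHom (nnToComplex H y)‖ *
        ‖1 - IndSpace.corner σ (1 : K →L[ℂ] K)‖ := by
  refine ContinuousLinearMap.opNorm_le_bound _ (by positivity) fun F => ?_
  set F' := (1 - IndSpace.corner σ (1 : K →L[ℂ] K)) F with hF'
  have h₀ : F' = F - IndSpace.base σ (F 1) := by
    rw [hF', sub_apply, corner_apply]; rfl
  have h₁ : F' 1 = 0 := by
    rw [h₀]
    change F 1 - IndSpace.base σ (F 1) 1 = 0
    rw [base_apply_one, sub_self]
  have h₂ : (URep.weighted ((indRep σ).comp H.subtype) y φ -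
      IndSpace.corner σ (URep.weighted σ y φ)) F =
      URep.weighted ((indRep σ).comp H.subtype) y φ F' := by
    rw [h₀, map_sub, weighted_base, sub_apply, corner_apply]
  rw [h₂, mul_assoc]
  refine (norm_weighted_le y hφ h₁).trans ?_
  gcongr
  exact ContinuousLinearMap.le_opNorm _ F

theorem URep.norm_weighted_le {Γ : Type*} [Group Γ] {E : Type*} [NormedAddCommGroup E]
    [InnerProductSpace ℂ E] [CompleteSpace E] (π : URep Γ E) (y : MonoidAlgebra ℝ≥0 Γ)
    {φ : Γ → ℂ} (hφ : ∀ s, ‖φ s‖ ≤ 1) : ‖π.weighted y φ‖ ≤ mass Γ y := by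
  rw [mass_eq_sum, NNReal.coe_sum]
  refine (norm_sum_le _ _).trans (Finset.sum_le_sum fun s _ => ?_)
  rw [norm_smul, norm_mul, Complex.norm_real, NNReal.norm_eq]
  have h₁ : ‖(π s : E →L[ℂ] E)‖ ≤ 1 :=
    ContinuousLinearMap.opNorm_le_bound _ zero_le_one fun v => by
      rw [Unitary.norm_map, one_mul]
  have := mul_le_one₀ (hφ s) (norm_nonneg _) h₁
  rw [mul_assoc]
  exact mul_le_of_le_one_right (NNReal.coe_nonneg _) this

/-- Weighting with the matrix coefficients of `σ` produces operators that do not all decay. -/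
theorem URep.sum_inner_weighted {Γ ι : Type*} [Group Γ] [Fintype ι] (σ : URep Γ K)
    (y : MonoidAlgebra ℝ≥0 Γ) (b : OrthonormalBasis ι ℂ K) (v : K) :
    ∑ i, inner ℂ (b i) (σ.weighted y (fun s => inner ℂ ((σ s : K →L[ℂ] K) v) (b i)) v) =
      ((mass Γ y : ℝ) : ℂ) * (‖v‖ : ℂ) ^ 2 := by
  simp only [URep.weighted, sum_apply, smul_apply, inner_sum, inner_smul_right]
  rw [Finset.sum_comm, mass_eq_sum, NNReal.coe_sum, Complex.ofReal_sum, Finset.sum_mul]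
  refine Finset.sum_congr rfl fun s _ => ?_
  simp only [mul_assoc]
  rw [← Finset.mul_sum, b.sum_inner_mul_inner, inner_self_eq_norm_sq_to_K, Unitary.norm_map]
  rfl

theorem IndSpace.nontrivial [Nontrivial K] (σ : URep H K) : Nontrivial (IndSpace σ) := by
  obtain ⟨u, hu⟩ := exists_ne (0 : K)
  refine ⟨IndSpace.base σ u, 0, fun h => hu ?_⟩
  rw [← IndSpace.base_apply_one (σ := σ) u, h]
  rfl

theorem URep.norm_nnToComplex_pow_le {Γ : Type*} [Group Γ] {E : Type*} [NormedAddCommGroup E]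
    [InnerProductSpace ℂ E] [CompleteSpace E] (π : URep Γ E) (y : MonoidAlgebra ℝ≥0 Γ) (n : ℕ) :
    ‖π.toAlgHom (nnToComplex Γ (y ^ n))‖ ≤ ‖π.toAlgHom (nnToComplex Γ y)‖ ^ n := by
  rw [map_pow, map_pow]
  -- On the zero space, which occurs for `H = G`, the identity has norm zero, so the exponent zero
  -- is treated apart.
  rcases n.eq_zero_or_pos with rfl | hn
  · rw [pow_zero, pow_zero]
    exact ContinuousLinearMap.norm_id_le
  · exact norm_pow_le' _ hn

variable [FiniteDimensional ℂ K]

/-- Under the spectral gap property, the algebra of the induced representation contains a nonzero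
operator of the corner. -/
theorem exists_corner_mem_cstar (hH : SpectralGapProperty H) [Nontrivial K] (σ : URep H K) :
    ∃ t : K →L[ℂ] K, t ≠ 0 ∧ IndSpace.corner σ t ∈ (indRep σ).cstar := by
  obtain ⟨y, hy1, hy⟩ := exists_norm_lt_one_of_not_weaklyContained hH
  obtain ⟨v, hv⟩ := exists_norm_eq K zero_le_one
  let b := stdOrthonormalBasis ℂ K
  -- The order of the arguments makes `φ i s` the conjugate of `⟪b i, σ(s) v⟫`, so their products
  -- add up to `‖σ(s) v‖ ^ 2`.
  let φ (i : Fin (Module.finrank ℂ K)) (s : H) : ℂ := inner ℂ ((σ s : K →L[ℂ] K) v) (b i)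
  have hφ : ∀ i s, ‖φ i s‖ ≤ 1 := fun i s => by
    refine (norm_inner_le_norm _ _).trans ?_
    rw [Unitary.norm_map, hv, b.norm_eq_one, one_mul]
  have hmass : ∀ n : ℕ, mass H (y ^ n) = 1 := fun n => by rw [map_pow, hy1, one_pow]
  let t (n : ℕ) (i : Fin (Module.finrank ℂ K)) : K →L[ℂ] K := URep.weighted σ (y ^ n) (φ i)
  have ht : ∀ n, t n ∈ Metric.closedBall (0 : Fin (Module.finrank ℂ K) → K →L[ℂ] K) 1 := by
    intro n
    rw [mem_closedBall_zero_iff, pi_norm_le_iff_of_nonneg zero_le_one]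
    intro i
    simpa [hmass] using σ.norm_weighted_le (y ^ n) (hφ i)
  have : ProperSpace (Fin (Module.finrank ℂ K) → K →L[ℂ] K) := FiniteDimensional.proper ℂ _
  -- One subsequence serves all basis indices at once, because which limit is nonzero is only known
  -- afterwards from `hsum`.
  obtain ⟨τ, -, k, hk, hτ⟩ := (isCompact_closedBall _ _).tendsto_subseq ht
  have hτi : ∀ i, Tendsto (fun n => t (k n) i) atTop (𝓝 (τ i)) := tendsto_pi_nhds.1 hτ
  have hsum : ∑ i, inner ℂ (b i) (τ i v) = (1 : ℂ) := by
    refine tendsto_nhds_unique (f := fun n => ∑ i, inner ℂ (b i) (t (k n) i v)) (l := atTop) ?_ ?_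
    · refine tendsto_finsetSum _ fun i _ => tendsto_const_nhds.inner ?_
      exact ((ContinuousLinearMap.apply ℂ K v).continuous.tendsto _).comp (hτi i)
    · refine tendsto_const_nhds.congr fun n => ?_
      rw [σ.sum_inner_weighted (y ^ k n) b v, hmass, hv]
      simp
  obtain ⟨i, hi⟩ : ∃ i, τ i ≠ 0 := by
    by_contra! hc
    simp [hc] at hsum
  refine ⟨τ i, hi, ?_⟩
  refine (indRep σ).isClosed_cstar.mem_of_tendsto (b := atTop)
    (f := fun n => URep.weighted ((indRep σ).comp H.subtype) (y ^ k n) (φ i)) ?_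
    (Eventually.of_forall fun n => IndSpace.weighted_mem_cstar _ _)
  have h₁ : Tendsto (fun n => IndSpace.corner σ (t (k n) i)) atTop
      (𝓝 (IndSpace.corner σ (τ i))) :=
    ((IndSpace.corner σ).continuous.tendsto _).comp (hτi i)
  -- Off the corner, the operators decay geometrically along the powers of the contracting measure.
  have h₂ : Tendsto (fun n => URep.weighted ((indRep σ).comp H.subtype) (y ^ k n) (φ i) -
      IndSpace.corner σ (t (k n) i)) atTop (𝓝 0) := by
    have h₃ : Tendsto (fun n => ‖(permRep H (cosetsNeBase H)).toAlgHom (nnToComplex H y)‖ ^ (k n) *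
        ‖1 - IndSpace.corner σ (1 : K →L[ℂ] K)‖) atTop (𝓝 0) := by
      have := ((tendsto_pow_atTop_nhds_zero_of_lt_one (norm_nonneg _) hy).comp
        hk.tendsto_atTop).mul_const ‖1 - IndSpace.corner σ (1 : K →L[ℂ] K)‖
      simpa using this
    refine squeeze_zero_norm (fun n => ?_) h₃
    refine (IndSpace.norm_weighted_sub_corner_le (y ^ k n) (hφ i)).trans ?_
    exact mul_le_mul_of_nonneg_right (URep.norm_nnToComplex_pow_le _ _ _) (norm_nonneg _)
  simpa using h₂.add h₁

/-- Under the spectral gap property, the algebra of the induced representation contains the rank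
one operators. -/
theorem rankOne_mem_cstar (hH : SpectralGapProperty H) {σ : URep H K} (hσ : σ.IsIrreducible)
    (F₁ F₂ : IndSpace σ) : rankOne ℂ F₁ F₂ ∈ (indRep σ).cstar := by
  have := hσ.1
  obtain ⟨t, ht, htA⟩ := exists_corner_mem_cstar hH σ
  have hcorner : ∀ r s : K →L[ℂ] K, IndSpace.corner σ (r * t * s) ∈ (indRep σ).cstar := by
    intro r s
    obtain ⟨x, rfl⟩ := hσ.toAlgHom_surjective r
    obtain ⟨y, rfl⟩ := hσ.toAlgHom_surjective s
    obtain ⟨a, ha, ha₁, -⟩ := IndSpace.exists_mem_cstar_intertwining (σ := σ) x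
    obtain ⟨c, hc, -, hc₂⟩ := IndSpace.exists_mem_cstar_intertwining (σ := σ) y
    have : IndSpace.corner σ (σ.toAlgHom x * t * σ.toAlgHom y) =
        a * IndSpace.corner σ t * c := by
      ext F
      rw [mul_apply_eq_comp, mul_apply_eq_comp, IndSpace.corner_apply, IndSpace.corner_apply, ha₁,
        hc₂]
      rfl
    rw [this]
    exact mul_mem (mul_mem ha htA) hc
  have hbase : ∀ u w : K,
      rankOne ℂ (IndSpace.base σ u) (IndSpace.base σ w) ∈ (indRep σ).cstar := by
    intro u w
    obtain ⟨x, hx⟩ : ∃ x, t x ≠ 0 := by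
      by_contra! hc
      exact ht (ContinuousLinearMap.ext hc)
    have hne : inner ℂ (t x) (t x) ≠ (0 : ℂ) := inner_self_ne_zero.2 hx
    -- Here `(u ⊗ t x) t (x ⊗ w) = ⟪t x, t x⟫ (u ⊗ w)`, the same sandwich as in the minimality of
    -- the compact ideal.
    have h₁ := (indRep σ).cstar.smul_mem (hcorner (rankOne ℂ u (t x)) (rankOne ℂ x w))
      (inner ℂ (t x) (t x))⁻¹
    rw [← map_smul] at h₁
    rw [← IndSpace.corner_rankOne]
    convert h₁ using 2
    ext z
    simp only [smul_apply, mul_apply_eq_comp, rankOne_apply, map_smul, smul_smul]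
    congr 1
    field_simp
  refine rankOne_mem_of_dense_span (S := (indRep σ).cstar.toSubalgebra.toSubmodule)
    (indRep σ).isClosed_cstar (IndSpace.dense_span_translates σ) ?_ F₁ F₂
  rintro _ ⟨g, u, rfl⟩ _ ⟨g', w, rfl⟩
  have h₁ := mul_mem (mul_mem ((indRep σ).apply_mem_cstar g) (hbase u w))
    (star_mem ((indRep σ).apply_mem_cstar g'))
  have h₂ : rankOne ℂ ((indRep σ g : IndSpace σ →L[ℂ] IndSpace σ) (IndSpace.base σ u))
      ((indRep σ g' : IndSpace σ →L[ℂ] IndSpace σ) (IndSpace.base σ w)) =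
      (indRep σ g : IndSpace σ →L[ℂ] IndSpace σ) *
        rankOne ℂ (IndSpace.base σ u) (IndSpace.base σ w) *
        star (indRep σ g' : IndSpace σ →L[ℂ] IndSpace σ) := by
    ext1 F
    rw [mul_apply_eq_comp, mul_apply_eq_comp, rankOne_apply, rankOne_apply, map_smul,
      ContinuousLinearMap.star_eq_adjoint, ContinuousLinearMap.adjoint_inner_right]
  rw [h₂]
  exact h₁

end Main

end SpectralGapInd

theorem mainTheorem3 {G : Type*} [Group G] [Countable G] (H : Subgroup G)
    (hH : SpectralGapInd.SpectralGapProperty H)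
    {K : Type*} [NormedAddCommGroup K] [InnerProductSpace ℂ K] [CompleteSpace K]
    [FiniteDimensional ℂ K] (σ : SpectralGapInd.URep H K) (hσ : σ.IsIrreducible) :
    ∃ I : TwoSidedIdeal (SpectralGapInd.indRep σ).cstar,
      IsLeast (SpectralGapInd.nonzeroClosedIdeals (SpectralGapInd.indRep σ).cstar) I ∧
      (∀ I' : TwoSidedIdeal (SpectralGapInd.indRep σ).cstar,
        IsLeast (SpectralGapInd.nonzeroClosedIdeals (SpectralGapInd.indRep σ).cstar) I' →
          I' = I) ∧
      Subtype.val '' (I : Set (SpectralGapInd.indRep σ).cstar) =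
        {T : SpectralGapInd.IndSpace σ →L[ℂ] SpectralGapInd.IndSpace σ | IsCompactOperator T} := by
  open SpectralGapInd in
  have := hσ.1
  have := IndSpace.nontrivial σ
  have hcl := (indRep σ).isClosed_cstar
  have hr := rankOne_mem_cstar hH hσ
  have hleast := isLeast_compactIdeal hcl hr
  refine ⟨compactIdeal _, hleast, fun I' hI' => hI'.unique hleast, ?_⟩
  ext T
  constructor
  · rintro ⟨a, ha, rfl⟩
    exact mem_compactIdeal.1 ha
  · intro hT
    exact ⟨⟨T, mem_of_isCompactOperator (S := (indRep σ).cstar.toSubalgebra.toSubmodule) hcl hr hT⟩,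
      mem_compactIdeal.2 hT, rfl⟩
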